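/- In the congested clique there are $n$ machines, with IDs $1,\dots,n$, that compute in synchronous rounds. Local computation is unrestricted, and at the end of each round every machine sends a (possibly different) message of $O(\log n)$ bits to every other machine. Let $\alpha$ be a real number such that $O(n^{\alpha})$ is a running time of matrix multiplication in this model. That is, for every constant $c$, two $n\times n$ integer matrices with entries of absolute value at most $n^{c}$, given so that machine $i$ holds row $i$ of both, can be multiplied deterministically in $O(n^{\alpha})$ rounds, after which machine $i$ holds row $i$ of the product. Write $\tilde O(f(n))$ for $O(f(n)\cdot\mathrm{poly}(\log n))$. For $p\in\mathbb N$ and a real matrix $A$ let $\mathrm{round}_p(A)$ be the matrix with entries $\lfloor 2^pA_{u,v}\rfloor/2^p$. For a square matrix $M$ let $M'(1)=\mathrm{round}_p(M)$ and $M'(k)=\mathrm{round}_p\big(M'(k/2)^2\big)$ for $k\ge 2$ a power of two. Lemma. Let $c_3,c_4,K,L>0$ be constants. There are $p=p(n)=O(\log^2 n)$ and $T=T(n)=\tilde O(n^{\alpha})$ such that the following holds for all $n\ge 1$, every power of two $k\le Kn^{c_3}$ and every $\beta\ge L/n^{c_4}$. There is a deterministic congested-clique algorithm with $T(n)$ rounds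 and messages of $O(\log n)$ bits, where the hidden constant depends only on $\alpha,c_3,c_4,K,L$, which for every $n\times n$ transition matrix $M$ (nonnegative real entries, all row sums equal to $1$), given so that machine $i$ holds row $i$ of $M$, ends with machine $i$ holding row $i$ of $M'(k)$, where the truncation is to $p(n)$ bits. Moreover, $M'(k)$ approximates $M^k$ with subtractive error at most $\beta$, i.e. $0\le (M^k)_{u,v}-M'(k)_{u,v}\le\beta$ for all $u,v$. -/

import Mathlib

open Filter Asymptotics

/-- A deterministic protocol of the congested clique with `n` machines, whose IDs are the elements
of `Fin n`, and with messages of `B` bits. Each machine starts with a local input in `In` and ends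
with a local output in `Out`; local computation is unrestricted. In every round each machine sends
to every machine a (possibly different) message of `B` bits, which depends only on its own ID and
local state, and then updates its local state from the messages that it receives. -/
structure CliqueProtocol (n B : ℕ) (In Out : Type) where
  State : Type
  init : Fin n → In → State
  send : Fin n → State → Fin n → (Fin B → Bool)
  update : Fin n → State → (Fin n → Fin B → Bool) → State
  output : Fin n → State → Out

/-- The local states of all machines after a number of synchronous rounds, on the inputs `x`. -/
def CliqueProtocol.states {n B : ℕ} {In Out : Type} (P : CliqueProtocol n B In Out)
    (x : Fin n → In) : ℕ → Fin n → P.State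
  | 0 => fun i => P.init i (x i)
  | t + 1 => fun i =>
      P.update i (P.states x t i) (fun s => P.send s (P.states x t s) i)

/-- What machine `i` outputs when the protocol is run for `T` rounds on the inputs `x`. -/
def CliqueProtocol.result {n B : ℕ} {In Out : Type} (P : CliqueProtocol n B In Out)
    (T : ℕ) (x : Fin n → In) (i : Fin n) : Out :=
  P.output i (P.states x T i)

/-- The message length in bits, `O(log n)` with hidden constant `b`. -/
def cliqueBits (b n : ℕ) : ℕ := b * (Nat.log 2 n + 1)

/-- `T = Õ(f)`: `T` is `O(f)` up to a factor that is polynomial in `log n`. -/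
def IsSoftO (T f : ℕ → ℝ) : Prop :=
  ∃ d : ℕ, T =O[atTop] fun n => f n * Real.log n ^ d

/-- `O(n ^ α)` is a running time of matrix multiplication in the congested clique: for each
constant `c`, two `n × n` integer matrices with entries of absolute value at most `n ^ c`
(that is, of `O(log n)` bits), distributed so that machine `i` holds row `i` of both, can be
multiplied in `O(n ^ α)` rounds with messages of `O(log n)` bits, so that machine `i` ends with
row `i` of the product. -/
def IsCliqueMatMulExponent (α : ℝ) : Prop :=
  ∀ c : ℕ, ∃ (b : ℕ) (T : ℕ → ℕ),
    ((fun n => (T n : ℝ)) =O[atTop] fun n : ℕ => (n : ℝ) ^ α) ∧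
    ∀ n : ℕ, 0 < n →
      ∃ P : CliqueProtocol n (cliqueBits b n) ((Fin n → ℤ) × (Fin n → ℤ)) (Fin n → ℤ),
        ∀ X Y : Matrix (Fin n) (Fin n) ℤ,
          (∀ i l, |X i l| ≤ (n : ℤ) ^ c) → (∀ i l, |Y i l| ≤ (n : ℤ) ^ c) →
          ∀ i, P.result (T n) (fun s => (X s, Y s)) i = (X * Y) i

/-- Truncation of every entry after `p` binary digits behind the point. -/
noncomputable def truncMatrix {n : ℕ} (p : ℕ) (A : Matrix (Fin n) (Fin n) ℝ) :
    Matrix (Fin n) (Fin n) ℝ :=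
  fun i l => (⌊A i l * 2 ^ p⌋ : ℝ) / 2 ^ p

/-- Repeated squaring, truncated after every step: the approximation of `M ^ (2 ^ j)`. -/
noncomputable def truncSquaring {n : ℕ} (p : ℕ) (M : Matrix (Fin n) (Fin n) ℝ) :
    ℕ → Matrix (Fin n) (Fin n) ℝ
  | 0 => truncMatrix p M
  | j + 1 => truncMatrix p (truncSquaring p M j * truncSquaring p M j)

/-! Truncation only rounds down and all matrices are nonnegative, so `truncSquaring` stays entrywise
below the true power. The error is therefore one-sided, and an entry's error is at most the deficit
of its row sum from 1 (`pow_sub_truncSquaring_le`). That deficit at most doubles per squaring, plus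
`n / 2 ^ p` for truncation (`le_sum_truncSquaring`); hence the error is at most `2 * k * n / 2 ^ p`,
and some `p = O(log n)` suffices.

Scaled by `2 ^ p`, truncated matrices are integer matrices with polynomially bounded entries, so
each squaring is one integer product between free local computations (`computes_truncSquare`). There
are `j = O(log n)` squarings, which costs one logarithmic factor. -/

namespace CliqueProtocol

/-! ### Sequential composition of protocols -/

variable {n B : ℕ} {In Mid Out : Type}

/-- The protocol that ignores all messages and applies `f` to the local input. -/
def ofLocal (n B : ℕ) (f : In → Out) : CliqueProtocol n B In Out where
  State := In
  init _ x := x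
  send _ _ _ _ := false
  update _ s _ := s
  output _ s := f s

theorem ofLocal_result (f : In → Out) (T : ℕ) (x : Fin n → In) (i : Fin n) :
    (ofLocal n B f).result T x i = f (x i) := by
  have h : ∀ T, (ofLocal n B f).states x T i = x i := by
    intro T
    induction T with
    | zero => rfl
    | succ T ih => exact ih
  exact congrArg f (h T)

/-- The local state of machine `i` in the sequential composition, when it has run `t` rounds of the
first protocol and is in its state `s`: the second protocol starts when `T` rounds are over. -/
def seqState (P : CliqueProtocol n B In Mid) (T : ℕ) (Q : CliqueProtocol n B Mid Out)
    (i : Fin n) (t : ℕ) (s : P.State) : (ℕ × P.State) ⊕ Q.State :=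
  if t < T then Sum.inl (t, s) else Sum.inr (Q.init i (P.output i s))

/-- Sequential composition: `T` rounds of `P`, and then `Q` on the outputs. -/
def seq (P : CliqueProtocol n B In Mid) (T : ℕ) (Q : CliqueProtocol n B Mid Out)
    (dflt : Fin n → Out) : CliqueProtocol n B In Out where
  State := (ℕ × P.State) ⊕ Q.State
  init i x := seqState P T Q i 0 (P.init i x)
  send i s := s.elim (fun a => P.send i a.2) (Q.send i)
  update i s m :=
    s.elim (fun a => seqState P T Q i (a.1 + 1) (P.update i a.2 m)) fun q => Sum.inr (Q.update i q m)
  output i s := s.elim (fun _ => dflt i) (Q.output i)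

/-- The handover belongs to the local update that ends round `T` (to the initialisation if `T = 0`),
so composition costs no extra round. -/
theorem seq_states_of_le (P : CliqueProtocol n B In Mid) (T : ℕ) (Q : CliqueProtocol n B Mid Out)
    (dflt : Fin n → Out) (x : Fin n → In) :
    ∀ t ≤ T, ∀ i, (seq P T Q dflt).states x t i = seqState P T Q i t (P.states x t i) := by
  intro t
  induction t with
  | zero => intro _ i; rfl
  | succ t ih =>
    intro ht i
    have h : (seq P T Q dflt).states x t = fun s => Sum.inl (t, P.states x t s) := by
      funext s
      rw [ih (by omega) s, seqState, if_pos (by omega)]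
    simp only [states, h]
    rfl

theorem seq_states_add (P : CliqueProtocol n B In Mid) (T : ℕ) (Q : CliqueProtocol n B Mid Out)
    (dflt : Fin n → Out) (x : Fin n → In) (t : ℕ) :
    (seq P T Q dflt).states x (T + t) = fun i => Sum.inr (Q.states (P.result T x) t i) := by
  induction t with
  | zero =>
    funext i
    rw [Nat.add_zero, seq_states_of_le P T Q dflt x T le_rfl i, seqState, if_neg (lt_irrefl T)]
    rfl
  | succ t ih =>
    funext i
    rw [← Nat.add_assoc]
    simp only [states, ih]
    rfl

theorem seq_result (P : CliqueProtocol n B In Mid) (T T' : ℕ) (Q : CliqueProtocol n B Mid Out)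
    (dflt : Fin n → Out) (x : Fin n → In) (i : Fin n) :
    (seq P T Q dflt).result (T + T') x i = Q.result T' (P.result T x) i := by
  simp only [result, seq_states_add]
  rfl

/-- Some protocol computes the distributed function `f` in `T` rounds on all inputs in `D`. -/
def Computes (B T : ℕ) (D : Set (Fin n → In)) (f : (Fin n → In) → Fin n → Out) : Prop :=
  ∃ P : CliqueProtocol n B In Out, ∀ x ∈ D, P.result T x = f x

theorem computes_local (B T : ℕ) (D : Set (Fin n → In)) (f : In → Out) :
    Computes B T D fun x i => f (x i) :=
  ⟨ofLocal n B f, fun x _ => funext fun i => ofLocal_result f T x i⟩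

theorem Computes.comp [Inhabited Out] {T T' : ℕ} {D : Set (Fin n → In)} {D' : Set (Fin n → Mid)}
    {f : (Fin n → In) → Fin n → Mid} {g : (Fin n → Mid) → Fin n → Out}
    (hf : Computes B T D f) (hg : Computes B T' D' g) (hD : ∀ x ∈ D, f x ∈ D') :
    Computes B (T + T') D fun x => g (f x) := by
  obtain ⟨P, hP⟩ := hf
  obtain ⟨Q, hQ⟩ := hg
  refine ⟨seq P T Q fun _ => default, fun x hx => ?_⟩
  funext i
  rw [seq_result, hP x hx, hQ _ (hD x hx)]

theorem Computes.congr {T : ℕ} {D : Set (Fin n → In)} {f g : (Fin n → In) → Fin n → Out}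
    (hf : Computes B T D f) (h : ∀ x ∈ D, f x = g x) : Computes B T D g := by
  obtain ⟨P, hP⟩ := hf
  exact ⟨P, fun x hx => (hP x hx).trans (h x hx)⟩

end CliqueProtocol

/-! ### Error analysis of truncated squaring -/

section Truncation

variable {n : ℕ}

theorem truncMatrix_le (p : ℕ) (A : Matrix (Fin n) (Fin n) ℝ) (i l : Fin n) :
    truncMatrix p A i l ≤ A i l := by
  rw [truncMatrix, div_le_iff₀ (by positivity)]
  exact Int.floor_le _

theorem sub_le_truncMatrix (p : ℕ) (A : Matrix (Fin n) (Fin n) ℝ) (i l : Fin n) :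
    A i l - 1 / 2 ^ p ≤ truncMatrix p A i l := by
  have h := Int.lt_floor_add_one (A i l * 2 ^ p)
  have h2 : (0 : ℝ) < 2 ^ p := by positivity
  rw [truncMatrix, le_div_iff₀ h2, sub_mul, one_div, inv_mul_cancel₀ h2.ne']
  linarith

theorem truncMatrix_nonneg (p : ℕ) {A : Matrix (Fin n) (Fin n) ℝ} {i l : Fin n}
    (h : 0 ≤ A i l) : 0 ≤ truncMatrix p A i l := by
  have : (0 : ℤ) ≤ ⌊A i l * 2 ^ p⌋ := Int.floor_nonneg.2 (by positivity)
  have : (0 : ℝ) ≤ (⌊A i l * 2 ^ p⌋ : ℝ) := by exact_mod_cast this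
  unfold truncMatrix
  positivity

theorem floor_truncMatrix_mul (p : ℕ) (A : Matrix (Fin n) (Fin n) ℝ) (i l : Fin n) :
    (⌊truncMatrix p A i l * 2 ^ p⌋ : ℝ) / 2 ^ p = truncMatrix p A i l := by
  have h2 : (2 : ℝ) ^ p ≠ 0 := by positivity
  simp only [truncMatrix, div_mul_cancel₀ _ h2, Int.floor_intCast]

theorem sum_truncMatrix_ge (p : ℕ) (A : Matrix (Fin n) (Fin n) ℝ) (i : Fin n) :
    ∑ l, A i l - n / 2 ^ p ≤ ∑ l, truncMatrix p A i l := by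
  calc ∑ l, A i l - n / 2 ^ p = ∑ l, (A i l - 1 / 2 ^ p) := by
        simp [Finset.sum_sub_distrib, div_eq_mul_inv]
    _ ≤ _ := Finset.sum_le_sum fun l _ => sub_le_truncMatrix p A i l

theorem truncSquaring_nonneg (p : ℕ) {M : Matrix (Fin n) (Fin n) ℝ}
    (hM : M ∈ Matrix.rowStochastic ℝ (Fin n)) (j : ℕ) :
    ∀ i l, 0 ≤ truncSquaring p M j i l := by
  induction j with
  | zero => exact fun i l => truncMatrix_nonneg p (hM.1 i l)
  | succ j ih =>
    exact fun i l => truncMatrix_nonneg p <| by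
      rw [Matrix.mul_apply]
      exact Finset.sum_nonneg fun w _ => mul_nonneg (ih i w) (ih w l)

theorem truncSquaring_le_pow (p : ℕ) {M : Matrix (Fin n) (Fin n) ℝ}
    (hM : M ∈ Matrix.rowStochastic ℝ (Fin n)) (j : ℕ) :
    ∀ i l, truncSquaring p M j i l ≤ (M ^ 2 ^ j) i l := by
  induction j with
  | zero =>
    intro i l
    simpa [truncSquaring] using truncMatrix_le p M i l
  | succ j ih =>
    intro i l
    refine (truncMatrix_le p _ i l).trans ?_
    rw [pow_succ, mul_two, pow_add, Matrix.mul_apply, Matrix.mul_apply]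
    exact Finset.sum_le_sum fun w _ =>
      mul_le_mul (ih i w) (ih w l) (truncSquaring_nonneg p hM j w l) ((pow_mem hM _).1 i w)

theorem truncSquaring_sum_le_one (p : ℕ) {M : Matrix (Fin n) (Fin n) ℝ}
    (hM : M ∈ Matrix.rowStochastic ℝ (Fin n)) (j : ℕ) (i : Fin n) :
    ∑ l, truncSquaring p M j i l ≤ 1 :=
  (Finset.sum_le_sum fun l _ => truncSquaring_le_pow p hM j i l).trans_eq
    (Matrix.sum_row_of_mem_rowStochastic (pow_mem hM _) i)

/-- Truncation decreases the row sums by at most `2 ^ (j + 1) * n / 2 ^ p`, because the deficit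
at most doubles with each squaring. -/
theorem le_sum_truncSquaring (p : ℕ) {M : Matrix (Fin n) (Fin n) ℝ}
    (hM : M ∈ Matrix.rowStochastic ℝ (Fin n)) (j : ℕ) :
    ∀ i, 1 - (2 ^ (j + 1) - 1) * (n / 2 ^ p) ≤ ∑ l, truncSquaring p M j i l := by
  induction j with
  | zero =>
    intro i
    refine le_trans ?_ (sum_truncMatrix_ge p M i)
    rw [Matrix.sum_row_of_mem_rowStochastic hM i]
    norm_num
  | succ j ih =>
    intro i
    set A := truncSquaring p M j with hA
    set d : ℝ := (2 ^ (j + 1) - 1) * (n / 2 ^ p) with hd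
    have hd0 : 0 ≤ d := by
      have : (1 : ℝ) ≤ 2 ^ (j + 1) := one_le_pow₀ one_le_two
      exact mul_nonneg (by linarith) (by positivity)
    -- Row sum `i` of `A * A` is the combination of the row sums of `A` with weights `A i w`. As the
    -- weights sum to between `1 - d` and `1`, it is at least `1 - 2 * d`.
    have h1 : (1 - d) * ∑ w, A i w ≤ ∑ l, (A * A) i l := by
      simp only [Matrix.mul_apply]
      rw [Finset.sum_comm, Finset.mul_sum]
      refine Finset.sum_le_sum fun w _ => ?_
      rw [← Finset.mul_sum, mul_comm]
      exact mul_le_mul_of_nonneg_left (ih w) (truncSquaring_nonneg p hM j i w)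
    have h2 := mul_le_mul_of_nonneg_left (truncSquaring_sum_le_one p hM j i) hd0
    have h3 := ih i
    have h4 : (2 ^ (j + 1 + 1) - 1) * ((n : ℝ) / 2 ^ p) = 2 * d + n / 2 ^ p := by
      rw [hd]; ring
    refine le_trans ?_ (sum_truncMatrix_ge p (A * A) i)
    rw [h4]
    linarith

/-- The differences along a row are nonnegative, so each is at most their sum, the deficit of the
row sum. -/
theorem pow_sub_truncSquaring_le (p : ℕ) {M : Matrix (Fin n) (Fin n) ℝ}
    (hM : M ∈ Matrix.rowStochastic ℝ (Fin n)) (j : ℕ) (i l : Fin n) :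
    (M ^ 2 ^ j) i l - truncSquaring p M j i l ≤ 2 * 2 ^ j * n / 2 ^ p := by
  have h1 : (M ^ 2 ^ j) i l - truncSquaring p M j i l ≤
      ∑ l, ((M ^ 2 ^ j) i l - truncSquaring p M j i l) :=
    Finset.single_le_sum (f := fun l => (M ^ 2 ^ j) i l - truncSquaring p M j i l)
      (fun l _ => sub_nonneg.2 (truncSquaring_le_pow p hM j i l)) (Finset.mem_univ l)
  rw [Finset.sum_sub_distrib, Matrix.sum_row_of_mem_rowStochastic (pow_mem hM _) i] at h1
  have h2 := le_sum_truncSquaring p hM j i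
  have h3 : 2 * 2 ^ j * (n : ℝ) / 2 ^ p = (2 ^ (j + 1) - 1) * (n / 2 ^ p) + n / 2 ^ p := by ring
  have h4 : (0 : ℝ) ≤ n / 2 ^ p := by positivity
  linarith

theorem truncSquaring_le_one (p : ℕ) {M : Matrix (Fin n) (Fin n) ℝ}
    (hM : M ∈ Matrix.rowStochastic ℝ (Fin n)) (j : ℕ) (i l : Fin n) :
    truncSquaring p M j i l ≤ 1 :=
  (Finset.single_le_sum (fun l _ => truncSquaring_nonneg p hM j i l) (Finset.mem_univ l)).trans
    (truncSquaring_sum_le_one p hM j i)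

theorem floor_truncSquaring (p : ℕ) (M : Matrix (Fin n) (Fin n) ℝ) (j : ℕ) (i l : Fin n) :
    (⌊truncSquaring p M j i l * 2 ^ p⌋ : ℝ) / 2 ^ p = truncSquaring p M j i l := by
  cases j <;> exact floor_truncMatrix_mul p _ i l

end Truncation

/-! ### From integer products to truncated squares -/

section Squaring

open CliqueProtocol

/-- The `n × n` matrices with entries in `[0, 1]` that have `p` binary digits behind the point. -/
def dyadicMatrices (n p : ℕ) : Set (Fin n → Fin n → ℝ) :=
  {A | ∀ i l, 0 ≤ A i l ∧ A i l ≤ 1 ∧ (⌊A i l * 2 ^ p⌋ : ℝ) / 2 ^ p = A i l}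

theorem truncSquaring_mem_dyadicMatrices {n : ℕ} (p : ℕ) {M : Matrix (Fin n) (Fin n) ℝ}
    (hM : M ∈ Matrix.rowStochastic ℝ (Fin n)) (j : ℕ) :
    truncSquaring p M j ∈ dyadicMatrices n p := fun i l =>
  ⟨truncSquaring_nonneg p hM j i l, truncSquaring_le_one p hM j i l, floor_truncSquaring p M j i l⟩

/-- A protocol for integer matrix products yields one for truncated squares of dyadic matrices. -/
theorem computes_truncSquare {n B T p c : ℕ} (hpc : (2 : ℤ) ^ p ≤ (n : ℤ) ^ c)
    (P : CliqueProtocol n B ((Fin n → ℤ) × (Fin n → ℤ)) (Fin n → ℤ))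
    (hP : ∀ X Y : Matrix (Fin n) (Fin n) ℤ,
      (∀ i l, |X i l| ≤ (n : ℤ) ^ c) → (∀ i l, |Y i l| ≤ (n : ℤ) ^ c) →
      ∀ i, P.result T (fun s => (X s, Y s)) i = (X * Y) i) :
    Computes B T (dyadicMatrices n p)
      fun A : Fin n → Fin n → ℝ => truncMatrix p (Matrix.of A * Matrix.of A) := by
  let pre : (Fin n → ℝ) → (Fin n → ℤ) × (Fin n → ℤ) := fun a =>
    (fun l => ⌊a l * 2 ^ p⌋, fun l => ⌊a l * 2 ^ p⌋)
  -- Both factors were scaled by `2 ^ p`, so the integer product is divided by `2 ^ p` twice before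
  -- truncation.
  let post : (Fin n → ℤ) → Fin n → ℝ := fun w l =>
    (⌊((w l : ℝ) / 2 ^ p / 2 ^ p) * 2 ^ p⌋ : ℝ) / 2 ^ p
  let D : Set (Fin n → (Fin n → ℤ) × (Fin n → ℤ)) :=
    {x | (∀ i l, |(x i).1 l| ≤ (n : ℤ) ^ c) ∧ (∀ i l, |(x i).2 l| ≤ (n : ℤ) ^ c)}
  have hmul : Computes B T D fun x =>
      (Matrix.of (fun i => (x i).1) * Matrix.of (fun i => (x i).2) : Matrix (Fin n) (Fin n) ℤ) :=
    ⟨P, fun x hx => funext fun i => hP (Matrix.of fun i => (x i).1) (Matrix.of fun i => (x i).2)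
      hx.1 hx.2 i⟩
  have hbound : ∀ A ∈ dyadicMatrices n p, ∀ i l, |⌊A i l * 2 ^ p⌋| ≤ (n : ℤ) ^ c := by
    intro A hA i l
    obtain ⟨h0, h1, -⟩ := hA i l
    rw [abs_of_nonneg (Int.floor_nonneg.2 (by positivity))]
    refine le_trans ?_ hpc
    have : A i l * 2 ^ p ≤ ((2 ^ p : ℤ) : ℝ) := by
      push_cast
      exact mul_le_of_le_one_left (by positivity) h1
    exact_mod_cast (Int.floor_le _).trans this
  have h := ((computes_local B 0 (dyadicMatrices n p) pre).comp hmul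
    fun A hA => ⟨hbound A hA, hbound A hA⟩).comp (computes_local B 0 Set.univ post)
    fun _ _ => Set.mem_univ _
  rw [Nat.zero_add, Nat.add_zero] at h
  refine h.congr fun A hA => ?_
  funext i l
  have key : (((Matrix.of (fun i => (pre (A i)).1) * Matrix.of (fun i => (pre (A i)).2) :
      Matrix (Fin n) (Fin n) ℤ) i l : ℤ) : ℝ) / 2 ^ p / 2 ^ p =
      (Matrix.of A * Matrix.of A) i l := by
    rw [Matrix.mul_apply, Matrix.mul_apply, Int.cast_sum, Finset.sum_div, Finset.sum_div]
    refine Finset.sum_congr rfl fun w _ => ?_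
    simp only [Matrix.of_apply, pre]
    conv_rhs => rw [← (hA i w).2.2, ← (hA w l).2.2]
    push_cast
    ring
  simp only [post, truncMatrix, key]

theorem computes_truncSquaring {n B T p : ℕ}
    (h : Computes B T (dyadicMatrices n p) fun A : Fin n → Fin n → ℝ =>
      truncMatrix p (Matrix.of A * Matrix.of A)) (j : ℕ) :
    Computes B (j * T) {M : Fin n → Fin n → ℝ | M ∈ Matrix.rowStochastic ℝ (Fin n)}
      fun M => truncSquaring p M j := by
  induction j with
  | zero =>
    rw [Nat.zero_mul]
    exact computes_local B 0 _ fun (a : Fin n → ℝ) l => (⌊a l * 2 ^ p⌋ : ℝ) / 2 ^ p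
  | succ j ih =>
    rw [Nat.succ_mul]
    exact ih.comp h fun M hM => truncSquaring_mem_dyadicMatrices p hM j

end Squaring

/-! ### Choice of parameters and the main theorem -/

theorem CliqueProtocol.Computes.of_le {n B T T' : ℕ} {In Out : Type} [Inhabited Out]
    {D : Set (Fin n → In)} {f : (Fin n → In) → Fin n → Out} (hf : Computes B T D f)
    (h : T ≤ T') : Computes B T' D f := by
  have := hf.comp (computes_local B (T' - T) Set.univ id) fun _ _ => Set.mem_univ _
  rwa [Nat.add_sub_cancel' h] at this

/-- A polynomial in `n` is at most a power of two whose exponent is linear in `log n`. -/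
theorem exists_mul_rpow_le_two_pow (a c : ℝ) :
    ∃ C : ℕ, ∀ n : ℕ, 0 < n → a * (n : ℝ) ^ c ≤ 2 ^ (C * (Nat.log 2 n + 1)) := by
  obtain ⟨A, hA⟩ := pow_unbounded_of_one_lt a (one_lt_two : (1 : ℝ) < 2)
  refine ⟨A + ⌈c⌉₊, fun n hn => ?_⟩
  have hn1 : (1 : ℝ) ≤ n := by exact_mod_cast hn
  have h1 : (n : ℝ) ^ c ≤ (2 ^ (Nat.log 2 n + 1)) ^ ⌈c⌉₊ := by
    calc (n : ℝ) ^ c ≤ (n : ℝ) ^ (⌈c⌉₊ : ℝ) := Real.rpow_le_rpow_of_exponent_le hn1 (Nat.le_ceil c)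
      _ = (n : ℝ) ^ ⌈c⌉₊ := Real.rpow_natCast _ _
      _ ≤ _ := by
        gcongr
        exact_mod_cast (Nat.lt_pow_succ_log_self one_lt_two n).le
  have h2 : a ≤ 2 ^ (A * (Nat.log 2 n + 1)) :=
    hA.le.trans (pow_le_pow_right₀ one_le_two (Nat.le_mul_of_pos_right _ (Nat.succ_pos _)))
  rw [Nat.add_mul, pow_add, mul_comm ⌈c⌉₊, pow_mul 2 _ ⌈c⌉₊]
  exact mul_le_mul h2 h1 (by positivity) (by positivity)

theorem isBigO_mul_natLog_add_one (C : ℕ) :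
    (fun n : ℕ => ((C * (Nat.log 2 n + 1) : ℕ) : ℝ)) =O[atTop] fun n : ℕ => Real.log n := by
  refine IsBigO.of_bound (C * (2 / Real.log 2)) ?_
  filter_upwards [eventually_ge_atTop 2] with n hn
  have hl2 : 0 < Real.log 2 := Real.log_pos one_lt_two
  have h1 : (Nat.log 2 n : ℝ) ≤ Real.log n / Real.log 2 := by
    rw [le_div_iff₀ hl2, ← Real.log_pow]
    apply Real.log_le_log (by positivity)
    exact_mod_cast Nat.pow_log_le_self 2 (by omega)
  have h2 : 1 ≤ Real.log n / Real.log 2 := by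
    rw [le_div_iff₀ hl2, one_mul]
    exact Real.log_le_log two_pos (by exact_mod_cast hn)
  have h3 : 0 ≤ Real.log n := Real.log_natCast_nonneg n
  rw [Real.norm_of_nonneg (by positivity), Real.norm_of_nonneg h3]
  push_cast
  calc (C : ℝ) * (Nat.log 2 n + 1) ≤ C * (2 * (Real.log n / Real.log 2)) := by
        gcongr; linarith
    _ = _ := by ring

theorem isBigO_log_sq_of_log {f : ℕ → ℝ} (hf : f =O[atTop] fun n : ℕ => Real.log n) :
    f =O[atTop] fun n : ℕ => Real.log n ^ 2 := by
  refine hf.trans (IsBigO.of_bound 1 ?_)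
  filter_upwards [(Real.tendsto_log_atTop.comp tendsto_natCast_atTop_atTop).eventually_ge_atTop 1]
    with n hn
  simp only [Function.comp_apply] at hn
  rw [Real.norm_of_nonneg (by linarith), Real.norm_of_nonneg (by positivity)]
  nlinarith

/-- `2 ^ (log n + 1) ≤ 2 * n ≤ n ^ 2`. This fails for `n = 1`, where `n ^ c` stays 1; that case is
treated separately. -/
theorem two_pow_mul_log_le {n : ℕ} (hn : 2 ≤ n) (C : ℕ) :
    (2 : ℤ) ^ (C * (Nat.log 2 n + 1)) ≤ (n : ℤ) ^ (2 * C) := by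
  have h : 2 ^ (Nat.log 2 n + 1) ≤ n ^ 2 := by
    rw [pow_succ, sq]
    exact Nat.mul_le_mul (Nat.pow_log_le_self 2 (by omega)) hn
  rw [mul_comm C, pow_mul, pow_mul]
  exact_mod_cast Nat.pow_le_pow_left h C

open CliqueProtocol in
/-- With a single machine, the local input is the whole matrix. -/
theorem computes_truncSquaring_one (B T p j : ℕ) (D : Set (Fin 1 → Fin 1 → ℝ)) :
    Computes B T D fun M => truncSquaring p M j :=
  (computes_local B T D fun a : Fin 1 → ℝ => truncSquaring p (fun _ => a) j 0).congr
    fun M _ => funext fun i => by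
      have h : (fun _ : Fin 1 => M i) = M := funext fun i' => by rw [Subsingleton.elim i' i]
      rw [h, Subsingleton.elim i 0]

theorem mainTheorem8 (α : ℝ) (hα : IsCliqueMatMulExponent α)
    (c₃ c₄ K L : ℝ) (hc₃ : 0 < c₃) (hc₄ : 0 < c₄) (hK : 0 < K) (hL : 0 < L) :
    ∃ (b : ℕ) (p T : ℕ → ℕ),
      ((fun n => (p n : ℝ)) =O[atTop] fun n : ℕ => Real.log n ^ 2) ∧
      IsSoftO (fun n => (T n : ℝ)) (fun n => (n : ℝ) ^ α) ∧
      ∀ n : ℕ, 0 < n →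
      ∀ k j : ℕ, k = 2 ^ j → (k : ℝ) ≤ K * (n : ℝ) ^ c₃ →
      ∀ β : ℝ, L / (n : ℝ) ^ c₄ ≤ β →
        ∃ P : CliqueProtocol n (cliqueBits b n) (Fin n → ℝ) (Fin n → ℝ),
          ∀ M : Matrix (Fin n) (Fin n) ℝ, M ∈ Matrix.rowStochastic ℝ (Fin n) →
            ∀ i : Fin n,
              P.result (T n) (fun s => M s) i = truncSquaring (p n) M j i ∧
              ∀ l : Fin n,
                0 ≤ (M ^ k) i l - P.result (T n) (fun s => M s) i l ∧
                (M ^ k) i l - P.result (T n) (fun s => M s) i l ≤ β := by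
  -- With `p = C * (log n + 1)`, the error `2 * k * n / 2 ^ p` is at most `L / n ^ c₄` for every `k
  -- ≤ K * n ^ c₃`.
  obtain ⟨C, hC⟩ := exists_mul_rpow_le_two_pow (2 * K / L) (1 + c₃ + c₄)
  -- Bounds the number `j` of squarings uniformly, so that idle rounds can pad every run to one
  -- length `T n`.
  obtain ⟨J, hJ⟩ := exists_mul_rpow_le_two_pow K c₃
  obtain ⟨b, T, hT, hmul⟩ := hα (2 * C)
  refine ⟨b, fun n => C * (Nat.log 2 n + 1), fun n => J * (Nat.log 2 n + 1) * T n,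
    isBigO_log_sq_of_log (isBigO_mul_natLog_add_one C), ⟨1, ?_⟩, ?_⟩
  · refine ((hT.mul (isBigO_mul_natLog_add_one J)).congr_left fun n => ?_).congr_right fun n => ?_
    · push_cast; ring
    · rw [pow_one]
  intro n hn k j hk hkn β hβ
  have hn0 : (0 : ℝ) < n := by exact_mod_cast hn
  have hk' : (k : ℝ) = 2 ^ j := by rw [hk]; push_cast; rfl
  have hjJ : j ≤ J * (Nat.log 2 n + 1) := by
    have : (2 : ℝ) ^ j ≤ 2 ^ (J * (Nat.log 2 n + 1)) := hk' ▸ hkn.trans (hJ n hn)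
    exact (pow_le_pow_iff_right₀ one_lt_two).1 this
  have hcomp : CliqueProtocol.Computes (cliqueBits b n) (J * (Nat.log 2 n + 1) * T n)
      {M : Fin n → Fin n → ℝ | M ∈ Matrix.rowStochastic ℝ (Fin n)}
      fun M => truncSquaring (C * (Nat.log 2 n + 1)) M j := by
    rcases Nat.lt_or_ge n 2 with h | h
    · obtain rfl : n = 1 := by omega
      exact computes_truncSquaring_one _ _ _ _ _
    · obtain ⟨P, hP⟩ := hmul n hn
      exact (computes_truncSquaring (computes_truncSquare (two_pow_mul_log_le h C) P hP) j).of_le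
        (Nat.mul_le_mul_right _ hjJ)
  have herr : 2 * 2 ^ j * (n : ℝ) / 2 ^ (C * (Nat.log 2 n + 1)) ≤ β := by
    refine le_trans ?_ hβ
    rw [div_le_div_iff₀ (by positivity) (by positivity), ← hk']
    have h1 := mul_le_mul_of_nonneg_left (hC n hn) hL.le
    rw [Real.rpow_add hn0, Real.rpow_add hn0, Real.rpow_one] at h1
    calc 2 * (k : ℝ) * n * (n : ℝ) ^ c₄ ≤ 2 * (K * (n : ℝ) ^ c₃) * n * (n : ℝ) ^ c₄ := by gcongr
      _ = L * (2 * K / L * (n * (n : ℝ) ^ c₃ * (n : ℝ) ^ c₄)) := by field_simp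
      _ ≤ _ := h1
  obtain ⟨P, hP⟩ := hcomp
  refine ⟨P, fun M hM i => ?_⟩
  have h : P.result (J * (Nat.log 2 n + 1) * T n) (fun s => M s) i =
      truncSquaring (C * (Nat.log 2 n + 1)) M j i := congrFun (hP M hM) i
  refine ⟨h, fun l => ?_⟩
  rw [h, hk]
  exact ⟨sub_nonneg.2 (truncSquaring_le_pow _ hM j i l),
    (pow_sub_truncSquaring_le _ hM j i l).trans herr⟩
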